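/- A \emph{Hilbert algebra} $(H,\to,1)$ satisfies $a\to(b\to a)=1$, $(a\to(b\to c))\to((a\to b)\to(a\to c))=1$, and $a\to b=b\to a=1\Rightarrow a=b$; its natural order is $a\le b\iff a\to b=1$. It is \emph{prelinear} if it belongs to the variety generated by the Hilbert algebras whose natural order is total, and \emph{bounded} if it has a constant $0$ which is its least element. Let $\mathrm{PHil}_0$ be the category of bounded prelinear Hilbert algebras with the maps preserving $\to,1,0$. An \emph{implicative filter} of $H$ is a subset $F$ with $1\in F$, and $b\in F$ whenever $a\in F$ and $a\to b\in F$; it is \emph{irreducible} if $F\neq H$ and, for all implicative filters $F_1,F_2$, $F=F_1\cap F_2$ implies $F=F_1$ or $F=F_2$. Let $X(H)$ be the set of irreducible implicative filters of $H$. For a topological space $X$ let $\mathrm{sat}(Y)$ be the intersection of all open sets containing $Y$, and let $x\le_d y$ mean $y\in\overline{\{x\}}$. A \emph{Hilbert space} ($H$-space) $(X,\mathcal K)$ is a sober space $X$ with a base $\mathcal K$ of compact open sets such that $\mathrm{sat}(U\cap V^c)\in\mathcal K$ for all $U,V\in\mathcal K$. An \emph{$H$-functional relation} from $(X_1,\mathcal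 K_1)$ to $(X_2,\mathcal K_2)$ is a relation $R\subseteq X_1\times X_2$ such that (i) $\{x: R(x)\cap U\ne\emptyset\}\in\mathcal K_1$ for all $U\in\mathcal K_2$; (ii) $R(x)$ is closed for every $x\in X_1$; (iii) if $(x,y)\in R$, then there is $z\in\overline{\{x\}}$ with $R(z)=\overline{\{y\}}$. Let $\mathrm{PHS}_0$ be the category whose objects are the $H$-spaces $(X,\mathcal K)$ with $X\in\mathcal K$ such that $(X,\le_d)$ is a root system (i.e. $\{y: x\le_d y\}$ is a chain for every $x$), and whose morphisms are the $H$-functional relations $R$ with $R(x)\ne\emptyset$ for every $x$; composition is composition of relations, and the identity of $X$ is $\le_d$. \textbf{Corollary.} The categories $\mathrm{PHil}_0$ and $\mathrm{PHS}_0$ are dually equivalent, i.e. there is an equivalence of categories $\mathrm{PHil}_0^{\mathrm{op}}\simeq\mathrm{PHS}_0$. It can be chosen as follows (up to renaming of points and elements). The functor $\mathrm{PHil}_0^{\mathrm{op}}\to\mathrm{PHS}_0$ sends $H$ to $X(H)$ with the base $\{\{P\in X(H): a\notin P\}: a\in H\}$, and sends $f:H\to G$ to $R_f=\{(P,Q)\in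 X(G)\times X(H): f^{-1}(P)\subseteq Q\}$. Its quasi-inverse sends $(X,\mathcal K)$ to $\{U\subseteq X: U^c\in\mathcal K\}$ with $U\Rightarrow V=\mathrm{sat}(U\cap V^c)^c$, $1=X$ and $0=\emptyset$, and sends $R\subseteq X_1\times X_2$ to the map $V\mapsto\{x\in X_1: R(x)\subseteq V\}$. -/

import Mathlib

open CategoryTheory Opposite

universe u

/-! ## Hilbert algebras -/

/-- Hilbert algebras `(H, ⇨, 1)`. The natural order is `a ≤ b ↔ a ⇨ b = 1`. -/
class HilbertAlgebra (H : Type u) extends HImp H, One H where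
  imp_weaken : ∀ a b : H, a ⇨ (b ⇨ a) = 1
  imp_distrib : ∀ a b c : H, (a ⇨ (b ⇨ c)) ⇨ ((a ⇨ b) ⇨ (a ⇨ c)) = 1
  imp_antisymm : ∀ a b : H, a ⇨ b = 1 → b ⇨ a = 1 → a = b

/-- Bounded Hilbert algebras `(H, ⇨, 1, 0)`: the constant `0` is the least element. -/
class BoundedHilbertAlgebra (H : Type u) extends HilbertAlgebra H, Zero H where
  zero_imp : ∀ a : H, 0 ⇨ a = 1

/-- A Hilbert chain: the natural order is total. -/
def IsHilbertChain (H : Type u) [HilbertAlgebra H] : Prop :=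
  ∀ a b : H, a ⇨ b = 1 ∨ b ⇨ a = 1

/-- Terms in the signature `(⇨, 1)` of type `(2, 0)`, in countably many variables. -/
inductive HilbertTerm : Type where
  | var : ℕ → HilbertTerm
  | one : HilbertTerm
  | imp : HilbertTerm → HilbertTerm → HilbertTerm

/-- Value of a term under an assignment of the variables. -/
def HilbertTerm.eval {H : Type u} [HilbertAlgebra H] (v : ℕ → H) : HilbertTerm → H
  | .var n => v n
  | .one => 1
  | .imp s t => s.eval v ⇨ t.eval v

/-- The identity `s ≈ t` holds in `H`. -/
def SatisfiesIdentity (H : Type u) [HilbertAlgebra H] (s t : HilbertTerm) : Prop :=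
  ∀ v : ℕ → H, s.eval v = t.eval v

/-- Prelinear Hilbert algebras: the members of the variety (equational class) generated by the
Hilbert chains, i.e. the algebras in which every identity valid in all Hilbert chains holds. -/
def IsPrelinear (H : Type u) [HilbertAlgebra H] : Prop :=
  ∀ s t : HilbertTerm,
    (∀ (C : Type u) [HilbertAlgebra C], IsHilbertChain C → SatisfiesIdentity C s t) →
      SatisfiesIdentity H s t

/-- Homomorphisms of bounded Hilbert algebras. -/
@[ext]
structure BoundedHilbertHom (H G : Type u) [BoundedHilbertAlgebra H]
    [BoundedHilbertAlgebra G] where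
  toFun : H → G
  map_imp : ∀ a b : H, toFun (a ⇨ b) = toFun a ⇨ toFun b
  map_one : toFun 1 = 1
  map_zero : toFun 0 = 0

/-- Objects of the category of bounded prelinear Hilbert algebras. -/
structure PHilz : Type (u + 1) where
  carrier : Type u
  [str : BoundedHilbertAlgebra carrier]
  prelinear : IsPrelinear carrier

attribute [instance] PHilz.str

instance : CoeSort PHilz.{u} (Type u) := ⟨PHilz.carrier⟩

/-- The algebraic category of bounded prelinear Hilbert algebras. -/
instance : Category PHilz.{u} where
  Hom H G := BoundedHilbertHom H G
  id H := ⟨id, fun _ _ => rfl, rfl, rfl⟩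
  comp f g :=
    { toFun := g.toFun ∘ f.toFun
      map_imp := fun a b => by simp [f.map_imp, g.map_imp]
      map_one := by simp [f.map_one, g.map_one]
      map_zero := by simp [f.map_zero, g.map_zero] }

/-! ## Irreducible implicative filters -/

/-- Implicative filters. -/
def IsImplicativeFilter {H : Type u} [HilbertAlgebra H] (F : Set H) : Prop :=
  1 ∈ F ∧ ∀ a b : H, a ∈ F → a ⇨ b ∈ F → b ∈ F

/-- Irreducible implicative filters: proper, and not the intersection of two other
implicative filters. -/
def IsIrreducibleFilter {H : Type u} [HilbertAlgebra H] (F : Set H) : Prop :=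
  IsImplicativeFilter F ∧ F ≠ Set.univ ∧
    ∀ F₁ F₂ : Set H, IsImplicativeFilter F₁ → IsImplicativeFilter F₂ →
      F = F₁ ∩ F₂ → F = F₁ ∨ F = F₂

/-- The set of irreducible implicative filters of `H`. -/
def IrrFilter (H : Type u) [HilbertAlgebra H] : Type u :=
  {F : Set H // IsIrreducibleFilter F}

/-! ## Hilbert spaces (`H`-spaces) -/

/-- `H`-spaces: sober (i.e. quasi-sober and `T₀`) spaces with a distinguished base of compact
open sets that contains `sat (U ∩ Vᶜ)` for all its members `U`, `V`. Mathlib's `nhdsKer Y`, the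
intersection of the open sets that contain `Y`, is the saturation of `Y`. -/
structure HilbertSpc : Type (u + 1) where
  carrier : Type u
  [top : TopologicalSpace carrier]
  basis : Set (Set carrier)
  isBasis : TopologicalSpace.IsTopologicalBasis basis
  isCompact : ∀ U ∈ basis, IsCompact U
  sat_diff_mem : ∀ U ∈ basis, ∀ V ∈ basis, nhdsKer (U ∩ Vᶜ) ∈ basis
  [t0 : T0Space carrier]
  [quasiSober : QuasiSober carrier]

attribute [instance] HilbertSpc.top HilbertSpc.t0 HilbertSpc.quasiSober

instance : CoeSort HilbertSpc.{u} (Type u) := ⟨HilbertSpc.carrier⟩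

/-- `H`-functional relations from `X` to `Y`, for `R : X → Y → Prop`. -/
structure IsHFunctional {X Y : HilbertSpc.{u}} (R : X → Y → Prop) : Prop where
  preimage_mem : ∀ U ∈ Y.basis, {x | ∃ y, R x y ∧ y ∈ U} ∈ X.basis
  isClosed_image : ∀ x, IsClosed {y | R x y}
  functional : ∀ x y, R x y → ∃ z ∈ closure {x}, {w | R z w} = closure {y}

theorem IsHFunctional.mono {X Y : HilbertSpc.{u}} {R : X → Y → Prop} (hR : IsHFunctional R)
    {x x' : X} (hx : x' ∈ closure {x}) {y : Y} (hy : R x' y) : R x y := by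
  by_contra hn
  obtain ⟨U, hU, hyU, hUs⟩ := Y.isBasis.exists_subset_of_mem_open
    (show y ∈ {y | R x y}ᶜ from hn) (hR.isClosed_image x).isOpen_compl
  have ho : IsOpen {x | ∃ y, R x y ∧ y ∈ U} := X.isBasis.isOpen (hR.preimage_mem U hU)
  obtain ⟨w, ⟨z, hz, hzU⟩, rfl⟩ := mem_closure_iff.1 hx _ ho ⟨y, hy, hyU⟩
  exact hUs hzU hz

/-- The relation `x ≤_d y`, i.e. `y ∈ closure {x}`, is `H`-functional. -/
theorem IsHFunctional.refl (X : HilbertSpc.{u}) :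
    IsHFunctional (X := X) (Y := X) (fun x y => y ∈ closure {x}) where
  preimage_mem U hU := by
    convert hU using 1
    ext x
    constructor
    · rintro ⟨y, hy, hyU⟩
      obtain ⟨w, hw, rfl⟩ := mem_closure_iff.1 hy U (X.isBasis.isOpen hU) hyU
      exact hw
    · exact fun hx => ⟨x, subset_closure rfl, hx⟩
  isClosed_image x := isClosed_closure
  functional x y hy := ⟨y, hy, rfl⟩

/-- The composite of two `H`-functional relations is `H`-functional. -/
theorem IsHFunctional.comp {X Y Z : HilbertSpc.{u}} {R : X → Y → Prop} {S : Y → Z → Prop}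
    (hR : IsHFunctional R) (hS : IsHFunctional S) :
    IsHFunctional (fun x z => ∃ y, R x y ∧ S y z) where
  preimage_mem U hU := by
    convert hR.preimage_mem _ (hS.preimage_mem U hU) using 1
    ext x
    constructor
    · rintro ⟨z, ⟨y, h1, h2⟩, h3⟩
      exact ⟨y, h1, z, h2, h3⟩
    · rintro ⟨y, h1, z, h2, h3⟩
      exact ⟨z, ⟨y, h1, h2⟩, h3⟩
  isClosed_image x := by
    rw [← closure_subset_iff_isClosed]
    intro z hz
    let T : Set Z → Set Y := fun U => {y | ∃ z, S y z ∧ z ∈ U}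
    -- closed sets meeting the preimages of all basic neighbourhoods of `z`
    let 𝒞 : Set (Set Y) := {C | IsClosed C ∧ C ⊆ {y | R x y} ∧
      ∀ U ∈ Z.basis, z ∈ U → (C ∩ T U).Nonempty}
    have h0 : {y | R x y} ∈ 𝒞 := by
      refine ⟨hR.isClosed_image x, subset_rfl, fun U hU hzU => ?_⟩
      obtain ⟨w, hw, y, hxy, hyw⟩ := mem_closure_iff.1 hz U (Z.isBasis.isOpen hU) hzU
      exact ⟨y, hxy, w, hyw, hw⟩
    obtain ⟨C, hCs, hC⟩ := zorn_superset_nonempty 𝒞 (by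
      intro c hc hchain hne
      refine ⟨⋂₀ c, ⟨isClosed_sInter fun s hs => (hc hs).1, ?_, ?_⟩,
        fun s hs => Set.sInter_subset_of_mem hs⟩
      · obtain ⟨s, hs⟩ := hne
        exact (Set.sInter_subset_of_mem hs).trans (hc hs).2.1
      · intro U hU hzU
        have hcomp : IsCompact (T U) := Y.isCompact _ (hS.preimage_mem U hU)
        by_contra hem
        rw [Set.not_nonempty_iff_eq_empty, Set.inter_comm, Set.sInter_eq_iInter] at hem
        have : Nonempty c := hne.to_subtype
        have hdir : Directed (· ⊇ ·) (fun s : c => (s : Set Y)) := by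
          intro s t
          rcases hchain.total s.2 t.2 with h | h
          · exact ⟨s, subset_rfl, h⟩
          · exact ⟨t, h, subset_rfl⟩
        obtain ⟨s, hs⟩ := hcomp.elim_directed_family_closed _ (fun s : c => (hc s.2).1) hem hdir
        obtain ⟨y, hy1, hy2⟩ := (hc s.2).2.2 U hU hzU
        exact Set.eq_empty_iff_forall_notMem.1 hs y ⟨hy2, hy1⟩) _ h0
    obtain ⟨⟨hCc, hCR, hCT⟩, hmin⟩ := hC
    obtain ⟨U₀, hU₀, hzU₀, -⟩ := Z.isBasis.exists_subset_of_mem_open (Set.mem_univ z) isOpen_univ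
    have hne : C.Nonempty := (hCT U₀ hU₀ hzU₀).mono Set.inter_subset_left
    have hirr : IsIrreducible C := by
      refine ⟨hne, isPreirreducible_iff_isClosed_union_isClosed.2 fun A B hA hB hAB => ?_⟩
      by_cases h1 : C ∩ A ∈ 𝒞
      · exact Or.inl fun y hy => (hmin h1 Set.inter_subset_left hy).2
      by_cases h2 : C ∩ B ∈ 𝒞
      · exact Or.inr fun y hy => (hmin h2 Set.inter_subset_left hy).2
      exfalso
      have key : ∀ D : Set Y, IsClosed D → C ∩ D ∉ 𝒞 →
          ∃ U ∈ Z.basis, z ∈ U ∧ ¬ (C ∩ D ∩ T U).Nonempty := by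
        intro D hD hn
        by_contra hcon
        push Not at hcon
        exact hn ⟨hCc.inter hD, Set.inter_subset_left.trans hCR, hcon⟩
      obtain ⟨U, hU, hzU, hUe⟩ := key A hA h1
      obtain ⟨V, hV, hzV, hVe⟩ := key B hB h2
      obtain ⟨W, hW, hzW, hWs⟩ := Z.isBasis.exists_subset_of_mem_open
        (show z ∈ U ∩ V from ⟨hzU, hzV⟩) ((Z.isBasis.isOpen hU).inter (Z.isBasis.isOpen hV))
      obtain ⟨y, hyC, w, hyw, hwW⟩ := hCT W hW hzW
      rcases hAB hyC with h | h
      · exact hUe ⟨y, ⟨hyC, h⟩, w, hyw, (hWs hwW).1⟩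
      · exact hVe ⟨y, ⟨hyC, h⟩, w, hyw, (hWs hwW).2⟩
    obtain ⟨y, hy⟩ := QuasiSober.sober hirr hCc
    refine ⟨y, hCR hy.mem, ?_⟩
    have hz' : z ∈ closure {z | S y z} := by
      rw [Z.isBasis.mem_closure_iff]
      intro U hU hzU
      obtain ⟨y', hy'C, hy'T⟩ := hCT U hU hzU
      rw [← hy.def] at hy'C
      obtain ⟨w, ⟨v, hv, hvU⟩, rfl⟩ := mem_closure_iff.1 hy'C _
        (Y.isBasis.isOpen (hS.preimage_mem U hU)) hy'T
      exact ⟨v, hvU, hv⟩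
    exact (hS.isClosed_image y).closure_subset hz'
  functional x z h := by
    obtain ⟨y, hxy, hyz⟩ := h
    obtain ⟨w, hw, hSw⟩ := hS.functional y z hyz
    have hxw : R x w := closure_minimal (s := {y}) (t := {y | R x y})
      (Set.singleton_subset_iff.2 hxy) (hR.isClosed_image x) hw
    obtain ⟨v, hv, hRv⟩ := hR.functional x w hxw
    refine ⟨v, hv, ?_⟩
    rw [← hSw]
    ext t
    constructor
    · rintro ⟨r, hr, hrt⟩
      have : r ∈ {w | R v w} := hr
      rw [hRv] at this
      exact hS.mono this hrt
    · intro ht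
      refine ⟨w, ?_, ht⟩
      have : w ∈ {w | R v w} := by rw [hRv]; exact subset_closure rfl
      exact this

/-- Objects of `PHSz`: `H`-spaces `X` with `X` in the base, for which the dual specialization
order `x ≤_d y ↔ y ∈ closure {x}` is a root system, i.e. every `{y | x ≤_d y}` is a chain. -/
structure PHSz : Type (u + 1) extends HilbertSpc.{u} where
  univ_mem : Set.univ ∈ basis
  rootSystem : ∀ x y z : carrier, y ∈ closure {x} → z ∈ closure {x} →
    z ∈ closure {y} ∨ y ∈ closure {z}

instance : CoeSort PHSz.{u} (Type u) := ⟨fun X => X.carrier⟩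

/-- Morphisms of `PHSz`: `H`-functional relations all of whose images `R(x)` are nonempty. -/
@[ext]
structure PHSzHom (X Y : PHSz.{u}) : Type u where
  rel : X → Y → Prop
  isHFunctional : IsHFunctional (X := X.toHilbertSpc) (Y := Y.toHilbertSpc) rel
  total : ∀ x, ∃ y, rel x y

/-- The category `PHSz`: composition is composition of relations, the identity is `≤_d`. -/
instance : Category PHSz.{u} where
  Hom X Y := PHSzHom X Y
  id X := ⟨fun x y => y ∈ closure {x}, IsHFunctional.refl X.toHilbertSpc,
    fun x => ⟨x, subset_closure rfl⟩⟩
  comp R S := ⟨fun x z => ∃ y, R.rel x y ∧ S.rel y z, R.isHFunctional.comp S.isHFunctional,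
    fun x => by
      obtain ⟨y, hy⟩ := R.total x
      obtain ⟨z, hz⟩ := S.total y
      exact ⟨z, y, hy, hz⟩⟩
  id_comp R := by
    apply PHSzHom.ext
    funext x z
    apply propext
    constructor
    · rintro ⟨y, hy, h⟩
      exact R.isHFunctional.mono hy h
    · exact fun h => ⟨x, subset_closure rfl, h⟩
  comp_id R := by
    apply PHSzHom.ext
    funext x z
    apply propext
    constructor
    · rintro ⟨y, h, hz⟩
      exact closure_minimal (s := {y}) (t := {y | R.rel x y})
        (Set.singleton_subset_iff.2 h) (R.isHFunctional.isClosed_image x) hz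
    · exact fun h => ⟨z, h, subset_closure rfl⟩
  assoc R S T := by
    apply PHSzHom.ext
    funext x z
    apply propext
    constructor
    · rintro ⟨y, ⟨w, h1, h2⟩, h3⟩
      exact ⟨w, h1, y, h2, h3⟩
    · rintro ⟨w, h1, y, h2, h3⟩
      exact ⟨y, ⟨w, h1, h2⟩, h3⟩

/-! ## The two contravariant functors -/

/-- `F` is, up to renaming of points, the functor that sends `H` to the set of its irreducible
implicative filters, with the base of all sets `{P | a ∉ P}` for `a : H`, and sends `f : H ⟶ G`
to the relation from filters of `G` to filters of `H` given by `f⁻¹(P) ⊆ Q`. -/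
def IsSpectrumFunctor (F : PHilz.{u}ᵒᵖ ⥤ PHSz.{u}) : Prop :=
  ∃ θ : ∀ H : PHilz.{u}, F.obj (op H) ≃ IrrFilter H,
    (∀ (H : PHilz.{u}) (U : Set (F.obj (op H))),
      U ∈ (F.obj (op H)).basis ↔ ∃ a : H, U = {x | a ∉ (θ H x).1}) ∧
    ∀ (H G : PHilz.{u}) (f : H ⟶ G) (x : F.obj (op G)) (y : F.obj (op H)),
      PHSzHom.rel (F.map f.op) x y ↔
        (BoundedHilbertHom.toFun f) ⁻¹' (θ G x).1 ⊆ (θ H y).1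

/-- `D` is, up to renaming of elements, the functor that sends `X` to the set of complements of
basic sets, with implication `U ⇨ V = (sat (U ∩ Vᶜ))ᶜ`, top `X` and bottom `∅`, and sends
`R : X ⟶ Y` to the map `V ↦ {x | R(x) ⊆ V}`. -/
def IsDualAlgebraFunctor (D : PHSz.{u} ⥤ PHilz.{u}ᵒᵖ) : Prop :=
  ∃ ψ : ∀ X : PHSz.{u}, (D.obj X).unop ≃ {U : Set X // Uᶜ ∈ X.basis},
    (∀ X : PHSz.{u},
      (∀ a b : (D.obj X).unop, (ψ X (a ⇨ b)).1 = (nhdsKer ((ψ X a).1 ∩ (ψ X b).1ᶜ))ᶜ) ∧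
      (ψ X 1).1 = Set.univ ∧ (ψ X 0).1 = ∅) ∧
    ∀ (X Y : PHSz.{u}) (R : X ⟶ Y) (b : (D.obj Y).unop),
      (ψ X (BoundedHilbertHom.toFun (D.map R).unop b)).1 =
        {x | {y | PHSzHom.rel R x y} ⊆ (ψ Y b).1}

/-!
The duality is a Stone-type duality whose points are the irreducible implicative filters.

On the algebraic side everything rests on two facts. A proper implicative filter is irreducible
exactly when any two elements outside it have an upper bound outside it
(`isIrreducibleFilter_iff`); the bound is the term `(a ⇨ c) ⇨ ((b ⇨ c) ⇨ c)`. And a filter that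
avoids a nonempty upwards directed set extends to an irreducible filter avoiding it
(`IsImplicativeFilter.exists_irreducible`). Taking a singleton as directed set shows that the
irreducible filters separate elements and describes `a ⇨ b ∈ P` through the filters above `P`;
taking the image under `f` of the complement of an irreducible filter `Q` produces an irreducible
filter `P` with `f⁻¹(P) = Q`
(`BoundedHilbertHom.exists_irreducible_preimage_eq`), which gives both the third axiom of
`H`-functional relations for `R_f` and the compatibility of `f ↦ R_f` with composition. Prelinearity
enters through the identity `((a ⇨ b) ⇨ c) ⇨ (((b ⇨ a) ⇨ c) ⇨ c) = 1`, which forces the irreducible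
filters above a given one to form a chain.

On the topological side, the members of the dual algebra of `(X, 𝒦)` are up-sets of `≤_d`, and
`U ⇨ V` is the Heyting implication of up-sets. Restricting up-sets to `closure {x}` is a
homomorphism into a Hilbert chain when `≤_d` is a root system, and these homomorphisms are jointly
injective; so the dual algebra satisfies all identities of Hilbert chains
(`StableSet.isPrelinear_of_injective`).

The unit `a ↦ {P | a ∈ P}` is bijective by separation. The counit `x ↦ {U | x ∈ U}` is injective by
the `T₀` axiom and surjective by sobriety, since compactness of the basic sets recovers a filter
from the intersection of its members (`PHSz.mem_iff_iInter_subset`). A closed set `R(x)` is the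
intersection of the members of the dual algebra containing it, whence naturality of the counit
(`PHSz.rel_iff_preimage_subset`).
-/

/-! ### Implicative filters -/

namespace HilbertAlgebra

variable {H : Type u} [HilbertAlgebra H]

theorem imp_one (a : H) : a ⇨ (1 : H) = 1 := by
  -- `1 ⇨ (a ⇨ 1)` and `(a ⇨ 1) ⇨ (1 ⇨ (a ⇨ 1))` are instances of weakening, and the latter
  -- reads `(a ⇨ 1) ⇨ 1 = 1`
  have h := imp_weaken (1 : H) a
  have h' := imp_weaken (a ⇨ (1 : H)) 1
  rw [h] at h'
  exact imp_antisymm _ _ h' h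

theorem eq_one_of_one_imp {a : H} (h : (1 : H) ⇨ a = 1) : a = 1 :=
  imp_antisymm _ _ (imp_one a) h

theorem imp_self (a : H) : a ⇨ a = 1 := by
  have h := imp_distrib a 1 a
  rw [imp_weaken, imp_one] at h
  exact eq_one_of_one_imp (eq_one_of_one_imp h)

end HilbertAlgebra

open HilbertAlgebra

theorem isImplicativeFilter_singleton_one {H : Type u} [HilbertAlgebra H] :
    IsImplicativeFilter ({1} : Set H) := by
  refine ⟨rfl, fun a b ha hab => ?_⟩
  rw [Set.mem_singleton_iff] at ha hab
  subst ha
  exact eq_one_of_one_imp hab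

namespace IsImplicativeFilter

variable {H : Type u} [HilbertAlgebra H] {F : Set H}

theorem weaken_mem (hF : IsImplicativeFilter F) {b : H} (hb : b ∈ F) (a : H) : a ⇨ b ∈ F :=
  hF.2 b _ hb (imp_weaken b a ▸ hF.1)

theorem mem_of_le (hF : IsImplicativeFilter F) {a b : H} (ha : a ∈ F) (hab : a ⇨ b = 1) : b ∈ F :=
  hF.2 a b ha (hab ▸ hF.1)

/-- The filter generated by `F` and `a` is `{x | a ⇨ x ∈ F}` (the deduction theorem). -/
theorem adjoin (hF : IsImplicativeFilter F) (a : H) : IsImplicativeFilter {x | a ⇨ x ∈ F} := by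
  refine ⟨hF.weaken_mem hF.1 a, fun b c hb hbc => ?_⟩
  exact hF.2 _ _ hb (hF.2 _ _ hbc (imp_distrib a b c ▸ hF.1))

theorem subset_adjoin (hF : IsImplicativeFilter F) (a : H) : F ⊆ {x | a ⇨ x ∈ F} :=
  fun _ hb => hF.weaken_mem hb a

theorem mem_adjoin_self (hF : IsImplicativeFilter F) (a : H) : a ∈ {x | a ⇨ x ∈ F} := by
  change a ⇨ a ∈ F
  rw [HilbertAlgebra.imp_self]
  exact hF.1

theorem imp_mem_of_le (hF : IsImplicativeFilter F) {a b c : H} (hab : a ⇨ b ∈ F)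
    (hbc : b ⇨ c = 1) : a ⇨ c ∈ F :=
  (hF.adjoin a).mem_of_le hab hbc

/-- The term `(a ⇨ c) ⇨ ((b ⇨ c) ⇨ c)` is an upper bound of `a` and `b` that behaves as a join
relative to `c`. -/
theorem exists_upper_bound (hF : IsImplicativeFilter F) {a b c : H} (ha : a ⇨ c ∈ F)
    (hb : b ⇨ c ∈ F) (hc : c ∉ F) : ∃ d ∉ F, a ⇨ d = 1 ∧ b ⇨ d = 1 := by
  refine ⟨(a ⇨ c) ⇨ ((b ⇨ c) ⇨ c), fun h => hc (hF.2 _ _ hb (hF.2 _ _ ha h)), ?_, ?_⟩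
  · have h1 := (isImplicativeFilter_singleton_one (H := H)).adjoin a
    have h2 := h1.adjoin (a ⇨ c)
    refine h2.weaken_mem (h2.2 a _ ?_ (h1.mem_adjoin_self _)) _
    exact h1.subset_adjoin _ (isImplicativeFilter_singleton_one.mem_adjoin_self a)
  · have h1 := (isImplicativeFilter_singleton_one (H := H)).adjoin b
    have h2 := h1.adjoin (a ⇨ c)
    have h3 := h2.adjoin (b ⇨ c)
    refine h3.2 b _ ?_ (h2.mem_adjoin_self _)
    exact h2.subset_adjoin _ (h1.subset_adjoin _
      (isImplicativeFilter_singleton_one.mem_adjoin_self b))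

theorem sUnion {c : Set (Set H)} (hc : ∀ F ∈ c, IsImplicativeFilter F) (hchain : IsChain (· ⊆ ·) c)
    (hne : c.Nonempty) : IsImplicativeFilter (⋃₀ c) := by
  obtain ⟨F₀, hF₀⟩ := hne
  refine ⟨⟨F₀, hF₀, (hc _ hF₀).1⟩, ?_⟩
  rintro a b ⟨F, hF, haF⟩ ⟨G, hG, habG⟩
  rcases hchain.total hF hG with h | h
  · exact ⟨G, hG, (hc _ hG).2 _ _ (h haF) habG⟩
  · exact ⟨F, hF, (hc _ hF).2 _ _ haF (h habG)⟩

theorem eq_univ_of_zero_mem {H : Type u} [BoundedHilbertAlgebra H] {F : Set H}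
    (hF : IsImplicativeFilter F) (h0 : (0 : H) ∈ F) : F = Set.univ :=
  Set.eq_univ_of_forall fun a => hF.mem_of_le h0 (BoundedHilbertAlgebra.zero_imp a)

theorem preimage {H G : Type u} [BoundedHilbertAlgebra H] [BoundedHilbertAlgebra G] {F : Set G}
    (hF : IsImplicativeFilter F) (f : BoundedHilbertHom H G) :
    IsImplicativeFilter (f.toFun ⁻¹' F) := by
  refine ⟨?_, fun a b ha hab => ?_⟩
  · rw [Set.mem_preimage, f.map_one]
    exact hF.1
  · rw [Set.mem_preimage, f.map_imp] at hab
    exact hF.2 _ _ ha hab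

end IsImplicativeFilter

/-- A proper filter is irreducible exactly when its complement is directed upwards. -/
theorem isIrreducibleFilter_iff {H : Type u} [HilbertAlgebra H] {F : Set H} :
    IsIrreducibleFilter F ↔ IsImplicativeFilter F ∧ F ≠ Set.univ ∧
      ∀ a ∉ F, ∀ b ∉ F, ∃ c ∉ F, a ⇨ c = 1 ∧ b ⇨ c = 1 := by
  constructor
  · rintro ⟨hF, hne, hirr⟩
    refine ⟨hF, hne, fun a ha b hb => ?_⟩
    have hsub : F ⊆ {x | a ⇨ x ∈ F} ∩ {x | b ⇨ x ∈ F} :=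
      Set.subset_inter (hF.subset_adjoin a) (hF.subset_adjoin b)
    by_cases h : {x | a ⇨ x ∈ F} ∩ {x | b ⇨ x ∈ F} ⊆ F
    · exfalso
      rcases hirr _ _ (hF.adjoin a) (hF.adjoin b) (hsub.antisymm h) with h | h
      · exact ha (h ▸ hF.mem_adjoin_self a)
      · exact hb (h ▸ hF.mem_adjoin_self b)
    · obtain ⟨c, ⟨hac, hbc⟩, hc⟩ := Set.not_subset.1 h
      exact hF.exists_upper_bound hac hbc hc
  · rintro ⟨hF, hne, hdir⟩
    refine ⟨hF, hne, fun F₁ F₂ h1 h2 h => ?_⟩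
    by_contra! hcon
    have hs1 : ¬ F₁ ⊆ F := fun hs => hcon.1 ((h ▸ Set.inter_subset_left).antisymm hs)
    have hs2 : ¬ F₂ ⊆ F := fun hs => hcon.2 ((h ▸ Set.inter_subset_right).antisymm hs)
    obtain ⟨a, ha, haF⟩ := Set.not_subset.1 hs1
    obtain ⟨b, hb, hbF⟩ := Set.not_subset.1 hs2
    obtain ⟨c, hc, hac, hbc⟩ := hdir a haF b hbF
    exact hc (h ▸ ⟨h1.mem_of_le ha hac, h2.mem_of_le hb hbc⟩)

/-- The separation lemma: a filter that avoids a nonempty upwards directed set `I` extends to an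
irreducible filter that avoids `I`, namely any maximal filter avoiding `I`. The last conjunct
records the maximality. -/
theorem IsImplicativeFilter.exists_irreducible {H : Type u} [HilbertAlgebra H] {F : Set H}
    (hF : IsImplicativeFilter F) {I : Set H} (hne : I.Nonempty)
    (hI : ∀ a ∈ I, ∀ b ∈ I, ∃ c ∈ I, a ⇨ c = 1 ∧ b ⇨ c = 1) (hFI : ∀ a ∈ I, a ∉ F) :
    ∃ P : IrrFilter H, F ⊆ P.1 ∧ (∀ a ∈ I, a ∉ P.1) ∧ ∀ a ∉ P.1, ∃ i ∈ I, a ⇨ i ∈ P.1 := by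
  obtain ⟨P, hFP, ⟨hP, hPI⟩, hmax⟩ := zorn_subset_nonempty
    {G : Set H | IsImplicativeFilter G ∧ ∀ a ∈ I, a ∉ G} (by
      intro c hc hchain hcne
      refine ⟨⋃₀ c, ⟨IsImplicativeFilter.sUnion (fun G hG => (hc hG).1) hchain hcne, ?_⟩,
        fun s hs => Set.subset_sUnion_of_mem hs⟩
      rintro a ha ⟨G, hG, haG⟩
      exact (hc hG).2 a ha haG) F ⟨hF, hFI⟩
  have key : ∀ a ∉ P, ∃ i ∈ I, a ⇨ i ∈ P := by
    intro a ha
    by_contra! hcon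
    exact ha (hmax ⟨hP.adjoin a, hcon⟩ (hP.subset_adjoin a) (hP.mem_adjoin_self a))
  obtain ⟨i, hi⟩ := hne
  refine ⟨⟨P, isIrreducibleFilter_iff.2 ⟨hP, fun h => hPI i hi (h ▸ trivial), ?_⟩⟩, hFP, hPI, key⟩
  intro a ha b hb
  obtain ⟨i, hi, hai⟩ := key a ha
  obtain ⟨j, hj, hbj⟩ := key b hb
  obtain ⟨k, hk, hik, hjk⟩ := hI i hi j hj
  exact hP.exists_upper_bound (hP.imp_mem_of_le hai hik) (hP.imp_mem_of_le hbj hjk) (hPI k hk)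

theorem IsImplicativeFilter.exists_irreducible_notMem {H : Type u} [HilbertAlgebra H] {F : Set H}
    (hF : IsImplicativeFilter F) {a : H} (ha : a ∉ F) :
    ∃ P : IrrFilter H, F ⊆ P.1 ∧ a ∉ P.1 := by
  obtain ⟨P, h1, h2, -⟩ := hF.exists_irreducible (Set.singleton_nonempty a)
    (by rintro _ rfl _ rfl; exact ⟨_, rfl, imp_self _, imp_self _⟩)
    (by rintro _ rfl; exact ha)
  exact ⟨P, h1, h2 a rfl⟩

/-- If an element lies in every filter containing `S`, then it lies in every filter containing
a suitable finite subset of `S`. -/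
theorem exists_finite_of_forall_filter {H : Type u} [HilbertAlgebra H] {S : Set H} {a : H}
    (h : ∀ F : Set H, IsImplicativeFilter F → S ⊆ F → a ∈ F) :
    ∃ T ⊆ S, T.Finite ∧ ∀ F : Set H, IsImplicativeFilter F → T ⊆ F → a ∈ F := by
  refine h {a | ∃ T ⊆ S, T.Finite ∧ ∀ F : Set H, IsImplicativeFilter F → T ⊆ F → a ∈ F}
    ⟨⟨∅, Set.empty_subset _, Set.finite_empty, fun F hF _ => hF.1⟩, ?_⟩ ?_
  · rintro b c ⟨T, hTS, hT, hb⟩ ⟨T', hTS', hT', hbc⟩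
    refine ⟨T ∪ T', Set.union_subset hTS hTS', hT.union hT', fun F hF hs => ?_⟩
    exact hF.2 _ _ (hb F hF (Set.subset_union_left.trans hs))
      (hbc F hF (Set.subset_union_right.trans hs))
  · exact fun b hb => ⟨{b}, Set.singleton_subset_iff.2 hb, Set.finite_singleton b,
      fun F _ hF => hF rfl⟩

/-! ### The spectrum of a Hilbert algebra -/

namespace IrrFilter

variable {H : Type u} [HilbertAlgebra H]

theorem isFilter (P : IrrFilter H) : IsImplicativeFilter P.1 := P.2.1

theorem exists_upper_bound (P : IrrFilter H) {a b : H} (ha : a ∉ P.1) (hb : b ∉ P.1) :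
    ∃ c ∉ P.1, a ⇨ c = 1 ∧ b ⇨ c = 1 :=
  (isIrreducibleFilter_iff.1 P.2).2.2 a ha b hb

theorem exists_notMem (P : IrrFilter H) : ∃ a, a ∉ P.1 := (Set.ne_univ_iff_exists_notMem _).1 P.2.2.1

theorem zero_notMem {H : Type u} [BoundedHilbertAlgebra H] (P : IrrFilter H) : (0 : H) ∉ P.1 :=
  fun h => P.2.2.1 (P.isFilter.eq_univ_of_zero_mem h)

/-- The basic open set of the irreducible filters that omit `a`. -/
def basicOpen (a : H) : Set (IrrFilter H) := {P | a ∉ P.1}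

/-- The topology on the spectrum generated by the sets `basicOpen a`. -/
instance : TopologicalSpace (IrrFilter H) :=
  TopologicalSpace.generateFrom (Set.range basicOpen)

theorem isTopologicalBasis :
    TopologicalSpace.IsTopologicalBasis (Set.range (basicOpen (H := H))) where
  exists_subset_inter := by
    rintro _ ⟨a, rfl⟩ _ ⟨b, rfl⟩ P ⟨ha, hb⟩
    obtain ⟨c, hc, hac, hbc⟩ := P.exists_upper_bound ha hb
    exact ⟨_, ⟨c, rfl⟩, hc, fun Q hQ =>
      ⟨fun h => hQ (Q.isFilter.mem_of_le h hac), fun h => hQ (Q.isFilter.mem_of_le h hbc)⟩⟩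
  sUnion_eq := Set.eq_univ_of_forall fun P => by
    obtain ⟨a, ha⟩ := P.exists_notMem
    exact ⟨_, ⟨a, rfl⟩, ha⟩
  eq_generateFrom := rfl

theorem isOpen_basicOpen (a : H) : IsOpen (basicOpen a) := isTopologicalBasis.isOpen ⟨a, rfl⟩

theorem specializes_iff {P Q : IrrFilter H} : P ⤳ Q ↔ P.1 ⊆ Q.1 := by
  rw [specializes_iff_forall_open]
  constructor
  · intro h a ha
    by_contra hn
    exact h _ (isOpen_basicOpen a) hn ha
  · intro h s hs hQ
    obtain ⟨_, ⟨a, rfl⟩, haQ, has⟩ := isTopologicalBasis.exists_subset_of_mem_open hQ hs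
    exact has fun haP => haQ (h haP)

theorem mem_closure_iff {P Q : IrrFilter H} : Q ∈ closure {P} ↔ P.1 ⊆ Q.1 := by
  rw [← specializes_iff_mem_closure, specializes_iff]

/-- A cover of `basicOpen a` by sets `basicOpen b` means that `a` lies in the filter generated by
these `b`, hence in the filter generated by finitely many of them. -/
theorem isCompact_basicOpen (a : H) : IsCompact (basicOpen a) := by
  refine isCompact_generateFrom rfl fun 𝒰 h𝒰 hcov => ?_
  obtain ⟨T, hTS, hT, haT⟩ := exists_finite_of_forall_filter (S := {b | basicOpen b ∈ 𝒰}) (a := a)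
    (by
      intro F hF hS
      by_contra ha
      obtain ⟨P, hFP, haP⟩ := hF.exists_irreducible_notMem ha
      obtain ⟨U, hU, hPU⟩ := hcov haP
      obtain ⟨b, rfl⟩ := h𝒰 hU
      exact hPU (hFP (hS hU)))
  refine ⟨basicOpen '' T, Set.image_subset_iff.2 hTS, hT.image _, fun P hP => ?_⟩
  by_contra hcon
  refine hP (haT P.1 P.isFilter fun b hb => ?_)
  by_contra hbP
  exact hcon ⟨_, ⟨b, hb, rfl⟩, hbP⟩

theorem imp_mem_iff {a b : H} {P : IrrFilter H} :
    a ⇨ b ∈ P.1 ↔ ∀ Q : IrrFilter H, P.1 ⊆ Q.1 → a ∈ Q.1 → b ∈ Q.1 := by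
  refine ⟨fun h Q hPQ ha => Q.isFilter.2 _ _ ha (hPQ h), fun h => ?_⟩
  by_contra hn
  obtain ⟨Q, hQ, hb⟩ := (P.isFilter.adjoin a).exists_irreducible_notMem hn
  exact hb (h Q ((P.isFilter.subset_adjoin a).trans hQ) (hQ (P.isFilter.mem_adjoin_self a)))

theorem nhdsKer_basicOpen_diff (a b : H) :
    nhdsKer (basicOpen b ∩ (basicOpen a)ᶜ) = basicOpen (a ⇨ b) := by
  ext P
  simp only [mem_nhdsKer_iff_specializes, specializes_iff, basicOpen, Set.mem_ofPred_eq, Set.mem_inter_iff,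
    Set.mem_compl_iff, not_not, imp_mem_iff, not_forall]
  constructor
  · rintro ⟨Q, ⟨hb, ha⟩, hPQ⟩
    exact ⟨Q, hPQ, ha, hb⟩
  · rintro ⟨Q, hPQ, ha, hb⟩
    exact ⟨Q, ⟨hb, ha⟩, hPQ⟩

instance : T0Space (IrrFilter H) where
  t0 _ _ h := Subtype.ext ((specializes_iff.1 h.specializes).antisymm
    (specializes_iff.1 h.specializes'))

/-- The generic point of an irreducible closed set of irreducible filters is their
intersection. -/
instance : QuasiSober (IrrFilter H) where
  sober {Z} hZ hZc := by
    have hF : IsImplicativeFilter {a : H | ∀ P ∈ Z, a ∈ P.1} :=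
      ⟨fun P _ => P.isFilter.1, fun a b ha hab P hP => P.isFilter.2 _ _ (ha P hP) (hab P hP)⟩
    have hirr : IsIrreducibleFilter {a : H | ∀ P ∈ Z, a ∈ P.1} := by
      refine isIrreducibleFilter_iff.2 ⟨hF, ?_, ?_⟩
      · obtain ⟨P, hP⟩ := hZ.1
        obtain ⟨a, ha⟩ := P.exists_notMem
        exact (Set.ne_univ_iff_exists_notMem _).2 ⟨a, fun h => ha (h P hP)⟩
      · intro a ha b hb
        simp only [Set.mem_ofPred_eq, not_forall] at ha hb
        obtain ⟨P, hPZ, hP⟩ := ha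
        obtain ⟨Q, hQZ, hQ⟩ := hb
        obtain ⟨N, hNZ, haN, hbN⟩ := hZ.2 _ _ (isOpen_basicOpen a) (isOpen_basicOpen b)
          ⟨P, hPZ, hP⟩ ⟨Q, hQZ, hQ⟩
        obtain ⟨c, hc, hac, hbc⟩ := N.exists_upper_bound haN hbN
        exact ⟨c, fun h => hc (h N hNZ), hac, hbc⟩
    refine ⟨⟨_, hirr⟩, ?_⟩
    change closure _ = Z
    ext Q
    refine (mem_closure_iff (H := H)).trans ?_
    constructor
    · intro hQ
      rw [← hZc.closure_eq, isTopologicalBasis.mem_closure_iff]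
      rintro _ ⟨a, rfl⟩ ha
      by_contra hcon
      refine ha (hQ fun P hP => ?_)
      by_contra haP
      exact hcon ⟨P, haP, hP⟩
    · exact fun hQ a ha => ha Q hQ

end IrrFilter

/-- In a Hilbert chain one of `a ⇨ b`, `b ⇨ a` is `1`, hence everything above both is `1`. -/
theorem IsPrelinear.eq_one_of_imp_le {H : Type u} [HilbertAlgebra H] (hH : IsPrelinear H)
    {a b c : H} (h1 : (a ⇨ b) ⇨ c = 1) (h2 : (b ⇨ a) ⇨ c = 1) : c = 1 := by
  let x : ℕ → HilbertTerm := HilbertTerm.var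
  have h := hH (((((x 0).imp (x 1)).imp (x 2))).imp ((((x 1).imp (x 0)).imp (x 2)).imp (x 2)))
    .one (by
      intro C _ hC v
      simp only [HilbertTerm.eval, x]
      have hF := isImplicativeFilter_singleton_one (H := C)
      have hF1 := hF.adjoin ((v 0 ⇨ v 1) ⇨ v 2)
      have hF2 := hF1.adjoin ((v 1 ⇨ v 0) ⇨ v 2)
      rcases hC (v 0) (v 1) with h | h
      · exact hF2.2 (v 0 ⇨ v 1) _ (h ▸ hF2.1)
          (hF1.subset_adjoin _ (hF.mem_adjoin_self _))
      · exact hF2.2 (v 1 ⇨ v 0) _ (h ▸ hF2.1) (hF1.mem_adjoin_self _))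
    (fun n => if n = 0 then a else if n = 1 then b else c)
  simp only [HilbertTerm.eval, x, if_true, one_ne_zero, if_false, OfNat.ofNat_ne_zero,
    OfNat.ofNat_ne_one, h1, h2] at h
  exact eq_one_of_one_imp (eq_one_of_one_imp h)

theorem IsPrelinear.subset_or_subset {H : Type u} [HilbertAlgebra H] (hH : IsPrelinear H)
    {P Q N : IrrFilter H} (hQ : P.1 ⊆ Q.1) (hN : P.1 ⊆ N.1) : Q.1 ⊆ N.1 ∨ N.1 ⊆ Q.1 := by
  by_contra! hcon
  obtain ⟨a, haQ, haN⟩ := Set.not_subset.1 hcon.1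
  obtain ⟨b, hbN, hbQ⟩ := Set.not_subset.1 hcon.2
  obtain ⟨c, hc, hac, hbc⟩ := P.exists_upper_bound
    (fun h : a ⇨ b ∈ P.1 => hbQ (Q.isFilter.2 _ _ haQ (hQ h)))
    (fun h : b ⇨ a ∈ P.1 => haN (N.isFilter.2 _ _ hbN (hN h)))
  exact hc (hH.eq_one_of_imp_le hac hbc ▸ P.isFilter.1)

/-- The spectrum of a bounded prelinear Hilbert algebra as an object of `PHSz`. -/
def PHilz.spectrum (H : PHilz.{u}) : PHSz.{u} where
  carrier := IrrFilter H
  basis := Set.range IrrFilter.basicOpen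
  isBasis := IrrFilter.isTopologicalBasis
  isCompact := by
    rintro _ ⟨a, rfl⟩
    exact IrrFilter.isCompact_basicOpen a
  sat_diff_mem := by
    rintro _ ⟨b, rfl⟩ _ ⟨a, rfl⟩
    exact ⟨a ⇨ b, (IrrFilter.nhdsKer_basicOpen_diff a b).symm⟩
  univ_mem := ⟨0, Set.eq_univ_of_forall fun P => P.zero_notMem⟩
  rootSystem P Q N hQ hN := by
    simp only [IrrFilter.mem_closure_iff] at *
    exact H.prelinear.subset_or_subset hQ hN

section SpectrumMap

variable {H G : Type u} [BoundedHilbertAlgebra H] [BoundedHilbertAlgebra G]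
  (f : BoundedHilbertHom H G)

theorem BoundedHilbertHom.map_mem_iff (P : IrrFilter G) (a : H) :
    f.toFun a ∈ P.1 ↔ ∀ Q : IrrFilter H, f.toFun ⁻¹' P.1 ⊆ Q.1 → a ∈ Q.1 := by
  refine ⟨fun h Q hQ => hQ h, fun h => ?_⟩
  by_contra hn
  obtain ⟨Q, hQ, ha⟩ := (P.isFilter.preimage f).exists_irreducible_notMem (a := a) hn
  exact ha (h Q hQ)

/-- The complement of an irreducible filter `Q` is directed, and so is its image under `f`. A maximal
filter `P` avoiding this image satisfies `f⁻¹(P) = Q`: if `q ∈ Q` had `f q ∉ P`, then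
`f q ⇨ f c = f (q ⇨ c) ∈ P` for some `c ∉ Q`, whence `q ⇨ c ∈ Q` and `c ∈ Q`. -/
theorem BoundedHilbertHom.exists_irreducible_preimage_eq {F : Set G}
    (hF : IsImplicativeFilter F) (Q : IrrFilter H) (h : f.toFun ⁻¹' F ⊆ Q.1) :
    ∃ P : IrrFilter G, F ⊆ P.1 ∧ f.toFun ⁻¹' P.1 = Q.1 := by
  obtain ⟨P, hFP, hP, hmax⟩ := hF.exists_irreducible (I := f.toFun '' (Q.1)ᶜ)
    (by
      obtain ⟨a, ha⟩ := Q.exists_notMem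
      exact ⟨_, a, ha, rfl⟩)
    (by
      rintro _ ⟨a, ha, rfl⟩ _ ⟨b, hb, rfl⟩
      obtain ⟨c, hc, hac, hbc⟩ := Q.exists_upper_bound ha hb
      exact ⟨_, ⟨c, hc, rfl⟩, by rw [← f.map_imp, hac, f.map_one],
        by rw [← f.map_imp, hbc, f.map_one]⟩)
    (by
      rintro _ ⟨a, ha, rfl⟩ haF
      exact ha (h haF))
  have hPQ : f.toFun ⁻¹' P.1 ⊆ Q.1 := fun a ha => by
    by_contra hn
    exact hP _ ⟨a, hn, rfl⟩ ha
  refine ⟨P, hFP, hPQ.antisymm fun q hq => ?_⟩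
  by_contra hn
  obtain ⟨_, ⟨c, hc, rfl⟩, hqc⟩ := hmax _ hn
  rw [← f.map_imp] at hqc
  exact hc (Q.isFilter.2 q c hq (hPQ hqc))

end SpectrumMap

/-- The relation `f⁻¹(P) ⊆ Q` between the spectra that is dual to a homomorphism `f`. -/
def PHilz.spectrumMap {H G : PHilz.{u}} (f : BoundedHilbertHom H G) :
    PHSzHom G.spectrum H.spectrum where
  rel := fun (P : IrrFilter G) (Q : IrrFilter H) => f.toFun ⁻¹' P.1 ⊆ Q.1
  isHFunctional :=
    { preimage_mem := by
        rintro _ ⟨a, rfl⟩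
        refine ⟨f.toFun a, ?_⟩
        ext P
        change f.toFun a ∉ P.1 ↔ _
        rw [f.map_mem_iff]
        push Not
        rfl
      isClosed_image := fun P => by
        rw [← closure_subset_iff_isClosed]
        intro Q hQ a ha
        by_contra hn
        obtain ⟨N, haN, hN⟩ := mem_closure_iff.1 hQ _ (IrrFilter.isOpen_basicOpen a) hn
        exact haN (hN ha)
      functional := fun P Q h => by
        obtain ⟨N, hPN, hN⟩ := f.exists_irreducible_preimage_eq (F := P.1) P.2.1 Q h
        refine ⟨N, IrrFilter.mem_closure_iff.2 hPN, ?_⟩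
        ext M
        exact (iff_of_eq (congrArg (· ⊆ M.1) hN)).trans IrrFilter.mem_closure_iff.symm }
  total := fun P => by
    obtain ⟨Q, hQ, -⟩ := (P.2.1.preimage f).exists_irreducible_notMem (a := (0 : H)) (by
      rw [Set.mem_preimage, f.map_zero]
      exact IrrFilter.zero_notMem P)
    exact ⟨Q, hQ⟩

/-- The contravariant spectrum functor. -/
def spectrumFunctor : PHilz.{u}ᵒᵖ ⥤ PHSz.{u} where
  obj H := H.unop.spectrum
  map f := PHilz.spectrumMap f.unop
  map_id H := by
    apply PHSzHom.ext
    funext P Q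
    exact propext IrrFilter.mem_closure_iff.symm
  map_comp {A B C} f g := by
    apply PHSzHom.ext
    funext P Q
    apply propext
    constructor
    · intro h
      obtain ⟨M, hM, hMQ⟩ := BoundedHilbertHom.exists_irreducible_preimage_eq g.unop
        (P.2.1.preimage f.unop) Q h
      exact ⟨M, hM, hMQ.subset⟩
    · rintro ⟨M, hM, hMQ⟩ a ha
      exact hMQ (hM ha)

/-! ### The dual algebra of an `H`-space -/

/-- The Hilbert algebra structure pulled back along an injective map preserving `⇨` and `1`. -/
abbrev HilbertAlgebra.ofInjective {A B : Type u} [HImp A] [One A] [HilbertAlgebra B] (φ : A → B)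
    (hφ : Function.Injective φ) (himp : ∀ a b, φ (a ⇨ b) = φ a ⇨ φ b) (hone : φ 1 = 1) :
    HilbertAlgebra A where
  imp_weaken a b := hφ (by rw [himp, himp, hone, imp_weaken])
  imp_distrib a b c := hφ (by simp only [himp, hone, imp_distrib])
  imp_antisymm a b h1 h2 := hφ (imp_antisymm _ _ (by rw [← himp, h1, hone])
    (by rw [← himp, h2, hone]))

theorem HilbertTerm.eval_map {A B : Type u} [HilbertAlgebra A] [HilbertAlgebra B] (φ : A → B)
    (himp : ∀ a b, φ (a ⇨ b) = φ a ⇨ φ b) (hone : φ 1 = 1) (v : ℕ → A) (t : HilbertTerm) :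
    φ (t.eval v) = t.eval (φ ∘ v) := by
  induction t with
  | var n => rfl
  | one => exact hone
  | imp s t hs ht => simp only [HilbertTerm.eval, himp, hs, ht]

/-- The subsets of a topological space that are closed under specialization, that is, the up-sets
of `≤_d`. -/
def StableSet (X : Type u) [TopologicalSpace X] : Type u :=
  {S : Set X // ∀ x y, x ⤳ y → x ∈ S → y ∈ S}

namespace StableSet

variable {X : Type u} [TopologicalSpace X]

instance : HImp (StableSet X) :=
  ⟨fun S T => ⟨{x | ∀ y, x ⤳ y → y ∈ S.1 → y ∈ T.1}, fun _ _ hxy hx z hyz => hx z (hxy.trans hyz)⟩⟩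

instance : One (StableSet X) := ⟨⟨Set.univ, fun _ _ _ _ => trivial⟩⟩

theorem mem_himp {S T : StableSet X} {x : X} :
    x ∈ (S ⇨ T).1 ↔ ∀ y, x ⤳ y → y ∈ S.1 → y ∈ T.1 := Iff.rfl

theorem himp_eq_one_iff {S T : StableSet X} : S ⇨ T = 1 ↔ S.1 ⊆ T.1 := by
  constructor
  · intro h x hx
    have : x ∈ (S ⇨ T).1 := by rw [h]; trivial
    exact this x specializes_rfl hx
  · intro h
    exact Subtype.ext (Set.eq_univ_of_forall fun x y _ hy => h hy)

/-- The up-sets of `≤_d` form a Hilbert algebra, in fact the implication reduct of a Heyting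
algebra. -/
instance : HilbertAlgebra (StableSet X) where
  imp_weaken S _ := himp_eq_one_iff.2 fun x hx y hxy _ => S.2 x y hxy hx
  imp_distrib _ _ _ := himp_eq_one_iff.2 fun _ hx _ hxy hy z hyz hz =>
    hx z (hxy.trans hyz) hz z specializes_rfl (hy z hyz hz)
  imp_antisymm _ _ h1 h2 := Subtype.ext ((himp_eq_one_iff.1 h1).antisymm (himp_eq_one_iff.1 h2))

theorem isHilbertChain (h : ∀ x y : X, x ⤳ y ∨ y ⤳ x) : IsHilbertChain (StableSet X) := by
  intro S T
  rw [himp_eq_one_iff, himp_eq_one_iff]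
  by_contra! hcon
  obtain ⟨x, hxS, hxT⟩ := Set.not_subset.1 hcon.1
  obtain ⟨y, hyT, hyS⟩ := Set.not_subset.1 hcon.2
  rcases h x y with h | h
  · exact hyS (S.2 x y h hxS)
  · exact hxT (T.2 y x h hyT)

/-- Restriction of a stable set to the closure of a point. -/
def restrict (x : X) (S : StableSet X) : StableSet (closure {x} : Set X) :=
  ⟨Subtype.val ⁻¹' S.1, fun _ _ h => S.2 _ _ ((subtype_specializes_iff _ _).1 h)⟩

theorem restrict_himp (x : X) (S T : StableSet X) :
    (S ⇨ T).restrict x = S.restrict x ⇨ T.restrict x := by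
  apply Subtype.ext
  ext y
  constructor
  · exact fun h z hyz hz => h z.1 ((subtype_specializes_iff _ _).1 hyz) hz
  · intro h z hyz hz
    have hzx : z ∈ closure {x} :=
      ((specializes_iff_mem_closure.2 y.2).trans hyz).mem_closure
    exact h ⟨z, hzx⟩ ((subtype_specializes_iff _ _).2 hyz) hz

theorem restrict_one (x : X) : (1 : StableSet X).restrict x = 1 := rfl

/-- An algebra of up-sets of a root system is prelinear, since it is a subdirect product of
algebras of up-sets of the chains `closure {x}`. -/
theorem isPrelinear_of_injective {A : Type u} [HilbertAlgebra A] (φ : A → StableSet X)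
    (hφ : Function.Injective φ) (himp : ∀ a b, φ (a ⇨ b) = φ a ⇨ φ b) (hone : φ 1 = 1)
    (hX : ∀ x y z : X, x ⤳ y → x ⤳ z → y ⤳ z ∨ z ⤳ y) : IsPrelinear A := by
  intro s t hst v
  have key : ∀ x, (φ (s.eval v)).restrict x = (φ (t.eval v)).restrict x := by
    intro x
    have hchain : IsHilbertChain (StableSet (closure {x} : Set X)) :=
      isHilbertChain fun y z => by
        simpa only [subtype_specializes_iff] using hX x y z
          (specializes_iff_mem_closure.2 y.2) (specializes_iff_mem_closure.2 z.2)
    have h1 (a b : A) : (φ (a ⇨ b)).restrict x = (φ a).restrict x ⇨ (φ b).restrict x := by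
      rw [himp, restrict_himp]
    have h2 : (φ 1).restrict x = 1 := by rw [hone, restrict_one]
    have hev := HilbertTerm.eval_map (fun a => (φ a).restrict x) h1 h2 v
    exact (hev s).trans ((hst _ hchain _).trans (hev t).symm)
  refine hφ (Subtype.ext (Set.ext fun x => ?_))
  have hx : x ∈ closure {x} := subset_closure rfl
  exact Set.ext_iff.1 (Subtype.ext_iff.1 (key x)) ⟨x, hx⟩

end StableSet

/-- The complements of the basic open sets of an `H`-space. -/
def PHSz.DualAlgebra (X : PHSz.{u}) : Type u := {U : Set X // Uᶜ ∈ X.basis}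

namespace PHSz.DualAlgebra

variable {X : PHSz.{u}}

theorem ext {U V : X.DualAlgebra} (h : ∀ x, x ∈ U.1 ↔ x ∈ V.1) : U = V := Subtype.ext (Set.ext h)

theorem isClosed (U : X.DualAlgebra) : IsClosed U.1 := ⟨X.isBasis.isOpen U.2⟩

theorem mem_of_specializes (U : X.DualAlgebra) {x y : X} (h : x ⤳ y) (hx : x ∈ U.1) : y ∈ U.1 :=
  h.mem_closed U.isClosed hx

theorem isCompact_compl (U : X.DualAlgebra) : IsCompact (U.1)ᶜ := X.isCompact _ U.2

theorem exists_of_isOpen {x : X} {s : Set X} (hs : IsOpen s) (hx : x ∈ s) :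
    ∃ U : X.DualAlgebra, x ∉ U.1 ∧ (U.1)ᶜ ⊆ s := by
  obtain ⟨V, hV, hxV, hVs⟩ := X.isBasis.exists_subset_of_mem_open hx hs
  exact ⟨⟨Vᶜ, by rwa [compl_compl]⟩, fun h => h hxV, by rwa [compl_compl]⟩

theorem exists_of_isClosed {x : X} {s : Set X} (hs : IsClosed s) (hx : x ∉ s) :
    ∃ U : X.DualAlgebra, x ∉ U.1 ∧ s ⊆ U.1 := by
  obtain ⟨U, hx, hU⟩ := exists_of_isOpen hs.isOpen_compl hx
  exact ⟨U, hx, Set.compl_subset_compl.1 hU⟩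

instance : HImp X.DualAlgebra :=
  ⟨fun U V => ⟨(nhdsKer (U.1 ∩ (V.1)ᶜ))ᶜ, by
    rw [compl_compl, Set.inter_comm]
    have h := X.sat_diff_mem _ V.2 _ U.2
    rwa [compl_compl] at h⟩⟩

instance : One X.DualAlgebra :=
  ⟨⟨Set.univ, by
    -- `∅` is basic, being the saturation of `univ ∩ univᶜ`
    have h := X.sat_diff_mem _ X.univ_mem _ X.univ_mem
    rwa [Set.inter_compl_self, nhdsKer_empty, ← Set.compl_univ] at h⟩⟩

theorem mem_himp {U V : X.DualAlgebra} {x : X} :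
    x ∈ (U ⇨ V).1 ↔ ∀ y, x ⤳ y → y ∈ U.1 → y ∈ V.1 := by
  change x ∉ nhdsKer _ ↔ _
  rw [mem_nhdsKer_iff_specializes]
  constructor
  · intro h y hxy hU
    by_contra hV
    exact h ⟨y, ⟨hU, hV⟩, hxy⟩
  · rintro h ⟨y, ⟨hU, hV⟩, hxy⟩
    exact hV (h y hxy hU)

/-- A member of the dual algebra is closed, hence an up-set of `≤_d`. -/
def toStableSet (U : X.DualAlgebra) : StableSet X := ⟨U.1, fun _ _ => U.mem_of_specializes⟩

theorem toStableSet_injective : Function.Injective (toStableSet (X := X)) :=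
  fun _ _ h => Subtype.ext (congrArg (fun S : StableSet X => S.1) h)

theorem toStableSet_himp (U V : X.DualAlgebra) :
    (U ⇨ V).toStableSet = U.toStableSet ⇨ V.toStableSet :=
  Subtype.ext (Set.ext fun _ => mem_himp)

theorem toStableSet_one : (1 : X.DualAlgebra).toStableSet = 1 := rfl

instance : HilbertAlgebra X.DualAlgebra :=
  HilbertAlgebra.ofInjective toStableSet toStableSet_injective toStableSet_himp toStableSet_one

theorem himp_eq_one_iff {U V : X.DualAlgebra} : U ⇨ V = 1 ↔ U.1 ⊆ V.1 := by
  rw [← toStableSet_injective.eq_iff, toStableSet_himp, toStableSet_one,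
    StableSet.himp_eq_one_iff]
  rfl

instance : BoundedHilbertAlgebra X.DualAlgebra where
  zero := ⟨∅, by rw [Set.compl_empty]; exact X.univ_mem⟩
  zero_imp _ := himp_eq_one_iff.2 (Set.empty_subset _)

theorem notMem_zero (x : X) : x ∉ (0 : X.DualAlgebra).1 := id

theorem isPrelinear : IsPrelinear X.DualAlgebra :=
  StableSet.isPrelinear_of_injective toStableSet toStableSet_injective toStableSet_himp
    toStableSet_one fun x y z hy hz => by
      simp only [specializes_iff_mem_closure] at *
      exact X.rootSystem x y z hy hz

end PHSz.DualAlgebra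

open PHSz (DualAlgebra)

/-- The bounded prelinear Hilbert algebra dual to an object of `PHSz`. -/
def PHSz.dual (X : PHSz.{u}) : PHilz.{u} where
  carrier := X.DualAlgebra
  prelinear := DualAlgebra.isPrelinear

/-- The homomorphism `V ↦ {x | R(x) ⊆ V}` dual to an `H`-functional relation `R`. -/
def PHSz.dualMap {X Y : PHSz.{u}} (R : PHSzHom X Y) :
    BoundedHilbertHom Y.DualAlgebra X.DualAlgebra where
  toFun V := ⟨{x | {y | R.rel x y} ⊆ V.1}, by
    convert R.isHFunctional.preimage_mem _ V.2 using 1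
    ext x
    exact Set.not_subset⟩
  map_imp U V := by
    refine DualAlgebra.ext fun x => Iff.trans ?_ DualAlgebra.mem_himp.symm
    constructor
    · intro h x' hx hU y hy
      exact DualAlgebra.mem_himp.1 (h (R.isHFunctional.mono hx.mem_closure hy)) y specializes_rfl
        (hU hy)
    · intro h y hy
      rw [DualAlgebra.mem_himp]
      intro z hyz hz
      -- a point `x'` above `x` with `R(x') = closure {z}` transfers membership of `z`
      obtain ⟨x', hx', hRx'⟩ := R.isHFunctional.functional x z
        (hyz.mem_closed (R.isHFunctional.isClosed_image x) hy)
      have hU : {w | R.rel x' w} ⊆ U.1 := by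
        rw [hRx']
        exact closure_minimal (Set.singleton_subset_iff.2 hz) U.isClosed
      refine h x' (specializes_iff_mem_closure.2 hx') hU ?_
      rw [hRx']
      exact subset_closure rfl
  map_one := Subtype.ext (Set.eq_univ_of_forall fun _ _ _ => trivial)
  map_zero := Subtype.ext (Set.eq_empty_of_forall_notMem fun x h => by
    obtain ⟨y, hy⟩ := R.total x
    exact h hy)

/-- The contravariant dual algebra functor. -/
def dualAlgebraFunctor : PHSz.{u} ⥤ PHilz.{u}ᵒᵖ where
  obj X := op X.dual
  map R := Quiver.Hom.op (V := PHilz) (PHSz.dualMap R)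
  map_id X := by
    refine congrArg Quiver.Hom.op (BoundedHilbertHom.ext (funext fun (V : X.DualAlgebra) =>
      Subtype.ext (Set.ext fun x => ?_)))
    exact ⟨fun h => h (subset_closure rfl), fun h =>
      closure_minimal (Set.singleton_subset_iff.2 h) V.isClosed⟩
  map_comp {X Y Z} R S := by
    refine congrArg Quiver.Hom.op (BoundedHilbertHom.ext (funext fun (V : Z.DualAlgebra) =>
      Subtype.ext (Set.ext fun x => ?_)))
    exact ⟨fun h y hy z hz => h ⟨y, hy, hz⟩, fun h z ⟨y, hy, hz⟩ => h hy hz⟩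

/-! ### The natural isomorphisms -/

/-- The bijection `a ↦ {P | a ∈ P}` from an algebra to the dual algebra of its spectrum. -/
noncomputable def PHilz.unitEquiv (H : PHilz.{u}) : H ≃ H.spectrum.DualAlgebra :=
  Equiv.ofBijective (fun a => ⟨(IrrFilter.basicOpen a)ᶜ, a, (compl_compl _).symm⟩) (by
    constructor
    · intro a b hab
      have h (P : IrrFilter H) : a ∈ P.1 ↔ b ∈ P.1 :=
        not_iff_not.1 (Set.ext_iff.1 (compl_injective (Subtype.ext_iff.1 hab)) P)
      have key : ∀ c d : H, (∀ P : IrrFilter H, c ∈ P.1 → d ∈ P.1) → c ⇨ d = 1 := by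
        intro c d hcd
        by_contra hn
        obtain ⟨P, -, hP⟩ :=
          (isImplicativeFilter_singleton_one (H := H)).exists_irreducible_notMem hn
        exact hP (IrrFilter.imp_mem_iff.2 fun Q _ => hcd Q)
      exact HilbertAlgebra.imp_antisymm _ _ (key a b fun P => (h P).1) (key b a fun P => (h P).2)
    · rintro ⟨U, a, ha⟩
      exact ⟨a, Subtype.ext (compl_eq_comm.1 ha.symm)⟩)

theorem PHilz.mem_unitEquiv {H : PHilz.{u}} {a : H} {P : IrrFilter H} :
    P ∈ (H.unitEquiv a).1 ↔ a ∈ P.1 := not_not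

theorem PHilz.unitEquiv_himp {H : PHilz.{u}} (a b : H) :
    H.unitEquiv (a ⇨ b) = H.unitEquiv a ⇨ H.unitEquiv b := by
  refine DualAlgebra.ext fun (P : IrrFilter H) => ?_
  refine Iff.trans (PHilz.mem_unitEquiv.trans (IrrFilter.imp_mem_iff.trans
    (forall_congr' fun Q => ?_))) (DualAlgebra.mem_himp (X := H.spectrum)).symm
  exact imp_congr IrrFilter.specializes_iff.symm
    (imp_congr PHilz.mem_unitEquiv.symm PHilz.mem_unitEquiv.symm)

/-- A bijection preserving `⇨`, `1` and `0` is an isomorphism. -/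
def PHilz.isoOfEquiv {H G : PHilz.{u}} (e : H ≃ G) (himp : ∀ a b, e (a ⇨ b) = e a ⇨ e b)
    (hone : e 1 = 1) (hzero : e 0 = 0) : H ≅ G where
  hom := { toFun := e, map_imp := himp, map_one := hone, map_zero := hzero }
  inv :=
    { toFun := e.symm
      map_imp := fun a b => by
        rw [Equiv.symm_apply_eq, himp, e.apply_symm_apply, e.apply_symm_apply]
      map_one := by rw [Equiv.symm_apply_eq, hone]
      map_zero := by rw [Equiv.symm_apply_eq, hzero] }
  hom_inv_id := BoundedHilbertHom.ext (funext e.symm_apply_apply)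
  inv_hom_id := BoundedHilbertHom.ext (funext e.apply_symm_apply)

/-- The isomorphism of an algebra with its double dual. -/
noncomputable def PHilz.unitIso (H : PHilz.{u}) : H ≅ H.spectrum.dual :=
  PHilz.isoOfEquiv (G := H.spectrum.dual) H.unitEquiv PHilz.unitEquiv_himp
    (Subtype.ext (Set.eq_univ_of_forall fun (P : IrrFilter H) =>
      PHilz.mem_unitEquiv.2 P.isFilter.1))
    (Subtype.ext (Set.eq_empty_of_forall_notMem fun (P : IrrFilter H) h =>
      P.zero_notMem (PHilz.mem_unitEquiv.1 h)))

namespace PHSz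

/-- The irreducible filter of the members of the dual algebra that contain `x`. -/
def pointFilter {X : PHSz.{u}} (x : X) : IrrFilter X.DualAlgebra :=
  ⟨{U | x ∈ U.1}, isIrreducibleFilter_iff.2
    ⟨⟨trivial, fun _ _ hU hUV => DualAlgebra.mem_himp.1 hUV x specializes_rfl hU⟩,
      fun h => DualAlgebra.notMem_zero x (Set.eq_univ_iff_forall.1 h 0),
      fun U hU V hV => by
        obtain ⟨W, hxW, hW⟩ := DualAlgebra.exists_of_isOpen
          (U.isClosed.isOpen_compl.inter V.isClosed.isOpen_compl) (show x ∈ (U.1)ᶜ ∩ (V.1)ᶜ from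
            ⟨hU, hV⟩)
        exact ⟨W, hxW,
          DualAlgebra.himp_eq_one_iff.2 (Set.compl_subset_compl.1 fun y hy => (hW hy).1),
          DualAlgebra.himp_eq_one_iff.2 (Set.compl_subset_compl.1 fun y hy => (hW hy).2)⟩⟩⟩

variable {X : PHSz.{u}}

theorem mem_pointFilter {x : X} {U : X.DualAlgebra} : U ∈ (pointFilter x).1 ↔ x ∈ U.1 := Iff.rfl

theorem pointFilter_injective : Function.Injective (pointFilter (X := X)) := by
  have key : ∀ x y : X, pointFilter x = pointFilter y → x ⤳ y := by
    intro x y h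
    rw [specializes_iff_mem_closure]
    by_contra hn
    obtain ⟨U, hU, hs⟩ := DualAlgebra.exists_of_isClosed isClosed_closure hn
    refine hU (mem_pointFilter.1 ?_)
    rw [← h]
    exact hs (subset_closure rfl)
  exact fun x y h => ((key x y h).antisymm (key y x h.symm)).eq

theorem mem_of_finite_inter_subset {F : Set X.DualAlgebra} (hF : IsImplicativeFilter F)
    {T : Set X.DualAlgebra} (hT : T.Finite) (hTF : T ⊆ F) (V : X.DualAlgebra)
    (hV : ⋂ U ∈ T, U.1 ⊆ V.1) : V ∈ F := by
  induction T, hT using Set.Finite.induction_on generalizing V with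
  | empty =>
    have h : V = 1 := Subtype.ext (Set.eq_univ_of_forall fun x => hV (by simp))
    exact h ▸ hF.1
  | @insert U T _ _ ih =>
    refine hF.2 U V (hTF (Set.mem_insert _ _)) (ih ((Set.subset_insert _ _).trans hTF) _ ?_)
    intro x hx
    rw [DualAlgebra.mem_himp]
    intro y hxy hy
    refine hV ?_
    rw [Set.biInter_insert]
    refine ⟨hy, ?_⟩
    simp only [Set.mem_iInter] at hx ⊢
    exact fun W hW => W.mem_of_specializes hxy (hx W hW)

/-- By compactness of the complement of `V`, a filter is recovered from the intersection of its
members. -/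
theorem mem_iff_iInter_subset {F : Set X.DualAlgebra} (hF : IsImplicativeFilter F)
    (V : X.DualAlgebra) : V ∈ F ↔ ⋂ U ∈ F, U.1 ⊆ V.1 := by
  refine ⟨fun h => Set.biInter_subset_of_mem h, fun h => ?_⟩
  obtain ⟨T, hTF, hT, hTV⟩ := V.isCompact_compl.elim_finite_subcover_image (b := F)
    (c := fun U => (U.1)ᶜ) (fun U _ => U.isClosed.isOpen_compl) (by
      rw [← Set.compl_iInter₂]
      exact Set.compl_subset_compl.2 h)
  rw [← Set.compl_iInter₂] at hTV
  exact mem_of_finite_inter_subset hF hT hTF V (Set.compl_subset_compl.1 hTV)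

/-- Sobriety yields every irreducible filter from the generic point of the intersection of its
members. -/
theorem pointFilter_surjective : Function.Surjective (pointFilter (X := X)) := by
  intro P
  have hmem := mem_iff_iInter_subset P.isFilter
  have hclosed : IsClosed (⋂ U ∈ P.1, U.1) := isClosed_biInter fun U _ => U.isClosed
  have hirr : IsIrreducible (⋂ U ∈ P.1, U.1) := by
    constructor
    · by_contra hn
      refine P.zero_notMem ((hmem 0).2 ?_)
      rw [Set.not_nonempty_iff_eq_empty.1 hn]
      exact Set.empty_subset _
    · rintro s t hs ht ⟨x, hx, hxs⟩ ⟨y, hy, hyt⟩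
      obtain ⟨U, hxU, hUs⟩ := DualAlgebra.exists_of_isOpen hs hxs
      obtain ⟨V, hyV, hVt⟩ := DualAlgebra.exists_of_isOpen ht hyt
      obtain ⟨W, hW, hUW, hVW⟩ := P.exists_upper_bound (a := U) (b := V)
        (fun h => hxU ((hmem U).1 h hx)) (fun h => hyV ((hmem V).1 h hy))
      rw [hmem] at hW
      obtain ⟨z, hz, hzW⟩ := Set.not_subset.1 hW
      exact ⟨z, hz, hUs fun h => hzW (DualAlgebra.himp_eq_one_iff.1 hUW h),
        hVt fun h => hzW (DualAlgebra.himp_eq_one_iff.1 hVW h)⟩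
  obtain ⟨x, hx⟩ := QuasiSober.sober hirr hclosed
  refine ⟨x, Subtype.ext (Set.ext fun V => ?_)⟩
  rw [hmem V, mem_pointFilter, ← hx.def]
  exact ⟨fun h => closure_minimal (Set.singleton_subset_iff.2 h) V.isClosed,
    fun h => h (subset_closure rfl)⟩

/-- The bijection between an `H`-space and the spectrum of its dual algebra. -/
noncomputable def counitEquiv (X : PHSz.{u}) : X ≃ X.dual.spectrum :=
  Equiv.ofBijective (pointFilter (X := X)) ⟨pointFilter_injective, pointFilter_surjective⟩

theorem mem_basis_counitEquiv (X : PHSz.{u}) (U : Set X.dual.spectrum) :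
    X.counitEquiv ⁻¹' U ∈ X.basis ↔ U ∈ X.dual.spectrum.basis := by
  constructor
  · intro h
    refine ⟨(⟨(X.counitEquiv ⁻¹' U)ᶜ, by rwa [compl_compl]⟩ : X.DualAlgebra), ?_⟩
    ext P
    obtain ⟨x, rfl⟩ := X.counitEquiv.surjective P
    exact not_not
  · rintro ⟨V, rfl⟩
    exact V.2

theorem continuous_of_preimage_mem_basis {X Y : PHSz.{u}} {f : X → Y}
    (hf : ∀ U ∈ Y.basis, f ⁻¹' U ∈ X.basis) : Continuous f :=
  Y.isBasis.continuous_iff.2 fun U hU => X.isBasis.isOpen (hf U hU)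

theorem mem_closure_iff_of_equiv {X Y : PHSz.{u}} (e : X ≃ Y)
    (he : ∀ U, e ⁻¹' U ∈ X.basis ↔ U ∈ Y.basis) (x x' : X) :
    e x' ∈ closure {e x} ↔ x' ∈ closure {x} := by
  rw [← specializes_iff_mem_closure, ← specializes_iff_mem_closure]
  refine ⟨fun h => ?_, fun h =>
    h.map (continuous_of_preimage_mem_basis fun U hU => (he U).2 hU)⟩
  have hc : Continuous e.symm := continuous_of_preimage_mem_basis fun U hU => by
    rw [← he, ← Set.preimage_comp, e.symm_comp_self]
    exact hU
  simpa using h.map hc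

/-- The relation `e x ≤_d y` attached to a bijection `e` that identifies the bases. -/
def homOfEquiv {X Y : PHSz.{u}} (e : X ≃ Y) (he : ∀ U, e ⁻¹' U ∈ X.basis ↔ U ∈ Y.basis) :
    PHSzHom X Y where
  rel x y := y ∈ closure {e x}
  isHFunctional :=
    { preimage_mem := fun U hU =>
        (he _).2 ((IsHFunctional.refl Y.toHilbertSpc).preimage_mem U hU)
      isClosed_image := fun x => isClosed_closure
      functional := fun x y h => by
        obtain ⟨z, rfl⟩ := e.surjective y
        exact ⟨z, (mem_closure_iff_of_equiv e he x z).1 h, rfl⟩ }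
  total x := ⟨e x, subset_closure rfl⟩

/-- A bijection that identifies the bases is an isomorphism in `PHSz`. -/
def isoOfEquiv {X Y : PHSz.{u}} (e : X ≃ Y) (he : ∀ U, e ⁻¹' U ∈ X.basis ↔ U ∈ Y.basis) :
    X ≅ Y where
  hom := homOfEquiv e he
  inv := homOfEquiv e.symm fun U => by
    rw [← he, ← Set.preimage_comp, e.symm_comp_self, Set.preimage_id]
  hom_inv_id := by
    apply PHSzHom.ext
    funext x x'
    apply propext
    constructor
    · rintro ⟨y, hxy, hy⟩
      obtain ⟨z, rfl⟩ := e.surjective y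
      change x' ∈ closure {e.symm (e z)} at hy
      rw [e.symm_apply_apply] at hy
      exact closure_minimal (Set.singleton_subset_iff.2
        ((mem_closure_iff_of_equiv e he x z).1 hxy)) isClosed_closure hy
    · intro h
      refine ⟨e x, subset_closure rfl, ?_⟩
      change x' ∈ closure {e.symm (e x)}
      rwa [e.symm_apply_apply]
  inv_hom_id := by
    apply PHSzHom.ext
    funext y y'
    apply propext
    constructor
    · rintro ⟨x, hx, hy⟩
      have h := (mem_closure_iff_of_equiv e he _ x).2 hx
      rw [e.apply_symm_apply] at h
      exact closure_minimal (Set.singleton_subset_iff.2 h) isClosed_closure hy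
    · intro h
      refine ⟨e.symm y, subset_closure rfl, ?_⟩
      change y' ∈ closure {e (e.symm y)}
      rwa [e.apply_symm_apply]

/-- The isomorphism of an `H`-space with its double dual. -/
noncomputable def counitIso (X : PHSz.{u}) : X ≅ X.dual.spectrum :=
  isoOfEquiv X.counitEquiv X.mem_basis_counitEquiv

theorem counitIso_rel_iff {x : X} {P : IrrFilter X.DualAlgebra} :
    PHSzHom.rel X.counitIso.hom x P ↔ (pointFilter x).1 ⊆ P.1 :=
  IrrFilter.mem_closure_iff

/-- Under the identification of points with filters, a relation is its own double dual, because
`R(x)` is closed and therefore an intersection of members of the dual algebra. -/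
theorem rel_iff_preimage_subset {X Y : PHSz.{u}} (R : PHSzHom X Y) {x : X} {y : Y} :
    R.rel x y ↔ (dualMap R).toFun ⁻¹' (pointFilter x).1 ⊆ (pointFilter y).1 := by
  refine ⟨fun h V hV => hV h, fun h => ?_⟩
  by_contra hn
  obtain ⟨U, hyU, hU⟩ := DualAlgebra.exists_of_isClosed (R.isHFunctional.isClosed_image x) hn
  exact hyU (h (a := U) hU)

end PHSz

/-- The duality between bounded prelinear Hilbert algebras and `H`-spaces. -/
noncomputable def hilbertDuality : PHilz.{u}ᵒᵖ ≌ PHSz.{u} :=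
  CategoryTheory.Equivalence.mk spectrumFunctor dualAlgebraFunctor
    (NatIso.ofComponents (fun H => H.unop.unitIso.op) fun {A B} f => by
      refine congrArg Quiver.Hom.op (BoundedHilbertHom.ext (funext fun (a : B.unop) =>
        DualAlgebra.ext fun (P : IrrFilter A.unop) => ?_))
      refine Iff.trans ?_ ((BoundedHilbertHom.map_mem_iff f.unop P a).symm.trans
        PHilz.mem_unitEquiv.symm)
      exact forall_congr' fun Q => imp_congr Iff.rfl PHilz.mem_unitEquiv).symm
    (NatIso.ofComponents (fun X => X.counitIso) fun {X Y} R => by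
      apply PHSzHom.ext
      funext x Q
      obtain ⟨y, rfl⟩ := Y.counitEquiv.surjective Q
      apply propext
      constructor
      · rintro ⟨y', hxy', h⟩
        exact ⟨PHSz.pointFilter x, subset_closure rfl,
          ((PHSz.rel_iff_preimage_subset R).1 hxy').trans (PHSz.counitIso_rel_iff.1 h)⟩
      · rintro ⟨P, hP, h⟩
        exact ⟨y, (PHSz.rel_iff_preimage_subset R).2
          ((Set.preimage_mono (PHSz.counitIso_rel_iff.1 hP)).trans h), subset_closure rfl⟩).symm

theorem mainTheorem7 :
    ∃ e : PHilz.{u}ᵒᵖ ≌ PHSz.{u},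
      IsSpectrumFunctor e.functor ∧ IsDualAlgebraFunctor e.inverse := by
  refine ⟨hilbertDuality, ⟨fun H => Equiv.refl _, ?_, ?_⟩, ⟨fun X => Equiv.refl _, ?_, ?_⟩⟩
  · intro H U
    exact exists_congr fun a => eq_comm
  · intro H G f x y
    exact Iff.rfl
  · exact fun X => ⟨fun a b => rfl, rfl, rfl⟩
  · intro X Y R b
    rfl
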